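/- Let $\mathcal{E}$ be an elementary topos with chosen finite products, and let $(\Sigma,E)$ be an algebraic variety, i.e. a set $\Sigma$ of operation symbols of finite arity together with a set $E$ of equations between terms in finitely many variables; $(\Sigma,E)$-algebras are taken in $\mathcal{E}$. All formulas below are in the internal language of $\mathcal{E}$. An internal commutative quantale is an object $Q$ of $\mathcal{E}$ with a commutative monoid structure $(\otimes,k)$, an internal partial order $\le$ and a join operation $\bigvee : P(Q)\to Q$ over which $\otimes$ distributes. A morphism $h : Q_1\to Q_2$ of internal commutative quantales is a homomorphism of internal monoids that preserves joins. Let $\mathbf{Rel}_{(\Sigma,E)}(Q)$ be the partially ordered symmetric monoidal category with: objects: the $(\Sigma,E)$-algebras in $\mathcal{E}$; morphisms $A\to B$: the algebraic $Q$-relations, i.e. the morphisms $R : A\times B\to Q$ of $\mathcal{E}$ such that $R(a_1,b_1)\otimes\cdots\otimes R(a_n,b_n)\le R(\sigma(a_1,\dots,a_n),\sigma(b_1,\dots,b_n))$ for every $n$-ary $\sigma\in\Sigma$; identities $1_A(a_1,a_2)=\bigvee\{k\mid a_1=a_2\}$ and composition $(S\circ R)(a,c)=\bigvee_b R(a,b)\otimes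 S(b,c)$; tensor product: the product of algebras on objects and $(R\otimes R')((a,a'),(b,b'))=R(a,b)\otimes R'(a',b')$ on morphisms, with the terminal algebra as unit; the associator, unitors and symmetry are the graphs $f_\circ(a,b)=\bigvee\{k\mid f(a)=b\}$ of those of the finite products; order: $R\subseteq R'$ iff $\forall a,b.\ R(a,b)\le R'(a,b)$. Then every morphism $h : Q_1\to Q_2$ of internal commutative quantales induces an identity-on-objects, strict symmetric monoidal $\mathbf{Pos}$-functor (i.e. a functor monotone on hom-posets) $$h^* : \mathbf{Rel}_{(\Sigma,E)}(Q_1)\to \mathbf{Rel}_{(\Sigma,E)}(Q_2),\qquad h^*(R)=\bigl(A\times B\xrightarrow{R}Q_1\xrightarrow{h}Q_2\bigr).$$ The assignment $h\mapsto h^*$ is functorial: $(1_Q)^*$ is the identity functor, and $(g\circ h)^*=g^*\circ h^*$ for $h : Q_1\to Q_2$ and $g : Q_2\to Q_3$. -/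

import Mathlib

open CategoryTheory MonoidalCategory CartesianMonoidalCategory Limits MonoidalClosed
open scoped MonObj

universe w v u

set_option linter.unusedSectionVars false

noncomputable section

namespace QRel

section InternalLogic

variable {E : Type u} [Category.{v} E] [CartesianMonoidalCategory E] [HasFiniteLimits E]
  [MonoidalClosed E] [HasSubobjectClassifier E]

/-- The object of truth values of the topos `E`. -/
abbrev Om (E : Type u) [Category.{v} E] [HasSubobjectClassifier E] : E :=
  HasSubobjectClassifier.Ω E

/-- The formula "true" in context `X`. -/
def top (X : E) : X ⟶ Om E := Subobject.Classifier.χ₀ _ X ≫ HasSubobjectClassifier.truth E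

/-- A formula `φ` in context `X` holds. -/
def Holds {X : E} (φ : X ⟶ Om E) : Prop := φ = top X

/-- The internal formula `p(x) = q(x)` in context `X`. -/
def eqF {X Z : E} (p q : X ⟶ Z) : X ⟶ Om E := HasSubobjectClassifier.χ (equalizer.ι p q)

/-- The internal conjunction `φ ∧ ψ`, i.e. `(φ, ψ) = (true, true)`. -/
def andF {X : E} (φ ψ : X ⟶ Om E) : X ⟶ Om E := eqF (lift φ ψ) (lift (top X) (top X))

/-- The internal implication `φ ⇒ ψ`, i.e. `(φ ∧ ψ) = φ`. -/
def impF {X : E} (φ ψ : X ⟶ Om E) : X ⟶ Om E := eqF (andF φ ψ) φ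

/-- The internal universal quantifier `∀ b : B, φ(b, x)`, i.e. `{b | φ(b, x)} = {b | true}`. -/
def allF {B X : E} (φ : B ⊗ X ⟶ Om E) : X ⟶ Om E := eqF (curry φ) (curry (top (B ⊗ X)))

/-- The internal existential quantifier `∃ b : B, φ(b, x)`, in its usual higher-order form
`∀ ω : Ω, (∀ b : B, φ(b, x) ⇒ ω) ⇒ ω`. -/
def exF {B X : E} (φ : B ⊗ X ⟶ Om E) : X ⟶ Om E :=
  allF (B := Om E)
    (impF (allF (B := B) (X := Om E ⊗ X) (impF (B ◁ snd (Om E) X ≫ φ) (snd B _ ≫ fst (Om E) X)))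
      (fst (Om E) X))

/-- The power object of `A`. -/
abbrev PowObj (A : E) : E := (ihom A).obj (Om E)

/-- Membership of a generalized element `a` of `A` in a generalized element `S` of the power
object of `A`. -/
def Mem {X A : E} (a : X ⟶ A) (S : X ⟶ PowObj A) : Prop :=
  Holds (lift a S ≫ (ihom.ev A).app (Om E))

/-- The internal comprehension term `{a : A | φ(a, x)}` in context `X`. -/
abbrev setOfF {A X : E} (φ : A ⊗ X ⟶ Om E) : X ⟶ PowObj A := curry φ

lemma comp_top {X Y : E} (f : Y ⟶ X) : f ≫ top X = top Y := by
  unfold top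
  rw [← Category.assoc]
  congr 1
  exact Subsingleton.elim _ _

lemma Holds.comp {X Y : E} {φ : X ⟶ Om E} (h : Holds φ) (f : Y ⟶ X) : Holds (f ≫ φ) := by
  unfold Holds at *
  rw [h, comp_top]

lemma holds_eqF {X Z Y : E} (p q : X ⟶ Z) (f : Y ⟶ X) :
    Holds (f ≫ eqF p q) ↔ f ≫ p = f ≫ q := by
  have hp := HasSubobjectClassifier.isPullback_χ (equalizer.ι p q)
  constructor
  · intro h
    have h' : f ≫ HasSubobjectClassifier.χ (equalizer.ι p q) =
        Subobject.Classifier.χ₀ _ Y ≫ HasSubobjectClassifier.truth E := h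
    have := hp.lift_fst f _ h'
    rw [← this, Category.assoc, Category.assoc, equalizer.condition]
  · intro h
    have hf : equalizer.lift f h ≫ equalizer.ι p q = f := equalizer.lift_ι f h
    unfold Holds eqF
    rw [← hf, Category.assoc, hp.w]
    exact comp_top _

lemma lift_comp_eq {X A B : E} {Z : E} (f : Z ⟶ X) (a : X ⟶ A) (b : X ⟶ B) :
    f ≫ lift a b = lift (f ≫ a) (f ≫ b) := comp_lift _ _ _

lemma holds_andF {X Y : E} (φ ψ : X ⟶ Om E) (f : Y ⟶ X) :
    Holds (f ≫ andF φ ψ) ↔ Holds (f ≫ φ) ∧ Holds (f ≫ ψ) := by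
  unfold andF
  rw [holds_eqF, comp_lift, comp_lift]
  unfold Holds
  rw [comp_top]
  constructor
  · intro h
    exact ⟨by simpa using congrArg (· ≫ fst _ _) h, by simpa using congrArg (· ≫ snd _ _) h⟩
  · rintro ⟨h1, h2⟩
    rw [h1, h2]

/-- Every formula is the classifying map of a subobject. -/
lemma om_le {X : E} (φ ψ : X ⟶ Om E)
    (h : ∀ {Y : E} (f : Y ⟶ X), Holds (f ≫ φ) ↔ Holds (f ≫ ψ)) : φ = ψ := by
  have key : ∀ (χ : X ⟶ Om E),
      IsPullback (equalizer.ι χ (top X)) (Subobject.Classifier.χ₀ _ _) χ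
        (HasSubobjectClassifier.truth E) := by
    intro χ
    refine ⟨⟨?_⟩, ⟨PullbackCone.IsLimit.mk _ (fun s => equalizer.lift s.fst ?_) ?_ ?_ ?_⟩⟩
    · rw [equalizer.condition]; exact comp_top _
    · rw [s.condition, comp_top]
      unfold top
      congr 1
      exact Subsingleton.elim _ _
    · intro s; exact equalizer.lift_ι _ _
    · intro s; exact Subsingleton.elim _ _
    · intro s m h1 _
      rw [← cancel_mono (equalizer.ι χ (top X)), h1]; exact (equalizer.lift_ι _ _).symm
  have hφ := key φ
  have e : equalizer.ι φ (top X) ≫ ψ = equalizer.ι φ (top X) ≫ top X := by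
    have := (h (equalizer.ι φ (top X))).1 (by
      unfold Holds; rw [equalizer.condition, comp_top])
    rw [comp_top]; exact this
  have e' : equalizer.ι ψ (top X) ≫ φ = equalizer.ι ψ (top X) ≫ top X := by
    have := (h (equalizer.ι ψ (top X))).2 (by
      unfold Holds; rw [equalizer.condition, comp_top])
    rw [comp_top]; exact this
  have hψ : IsPullback (equalizer.ι φ (top X)) (Subobject.Classifier.χ₀ _ _) ψ
        (HasSubobjectClassifier.truth E) := by
    refine IsPullback.of_iso (key ψ) (e₁ := ⟨equalizer.lift _ e', equalizer.lift _ e, ?_, ?_⟩)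
      (e₂ := Iso.refl _) (e₃ := Iso.refl _) (e₄ := Iso.refl _) ?_ ?_ ?_ ?_
    · rw [← cancel_mono (equalizer.ι ψ (top X))]; simp
    · rw [← cancel_mono (equalizer.ι φ (top X))]; simp
    · simp
    · exact Subsingleton.elim _ _
    · simp
    · simp
  rw [HasSubobjectClassifier.unique _ φ hφ, HasSubobjectClassifier.unique _ ψ hψ]

lemma holds_impF {X Y : E} (φ ψ : X ⟶ Om E) (f : Y ⟶ X) :
    Holds (f ≫ impF φ ψ) ↔ ∀ {Z : E} (g : Z ⟶ Y), Holds (g ≫ f ≫ φ) → Holds (g ≫ f ≫ ψ) := by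
  unfold impF
  rw [holds_eqF]
  constructor
  · intro h Z g hg
    have : Holds ((g ≫ f) ≫ andF φ ψ) := by
      rw [Category.assoc, h]; exact hg
    rw [holds_andF] at this
    simpa using this.2
  · intro h
    apply om_le
    intro Z g
    rw [← Category.assoc, holds_andF]
    simp only [Category.assoc]
    exact ⟨fun h => h.1, fun h' => ⟨h', h g h'⟩⟩

lemma mem_setOfF {A X Y : E} (φ : A ⊗ X ⟶ Om E) (f : Y ⟶ X) (a : Y ⟶ A) :
    Mem a (f ≫ setOfF φ) ↔ Holds (lift a f ≫ φ) := by
  unfold Mem setOfF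
  have : lift a (f ≫ curry φ) ≫ (ihom.ev A).app (Om E) = lift a f ≫ φ := by
    have h : lift a (f ≫ curry φ) = lift a f ≫ A ◁ curry φ := by
      rw [lift_whiskerLeft]
    rw [h, Category.assoc, whiskerLeft_curry_ihom_ev_app]
  rw [this]

lemma holds_allF {B X Y : E} (φ : B ⊗ X ⟶ Om E) (f : Y ⟶ X) :
    Holds (f ≫ allF φ) ↔ ∀ {Z : E} (g : Z ⟶ Y) (b : Z ⟶ B), Holds (lift b (g ≫ f) ≫ φ) := by
  unfold allF
  rw [holds_eqF, ← curry_natural_left, ← curry_natural_left]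
  constructor
  · intro h Z g b
    have h2 := curry_injective h
    have : lift b (g ≫ f) ≫ φ = lift b g ≫ (B ◁ f ≫ φ) := by
      rw [← Category.assoc, lift_whiskerLeft]
    rw [this, h2]
    unfold Holds
    rw [comp_top, comp_top]
  · intro h
    congr 1
    rw [comp_top]
    have := h (snd B Y) (fst B Y)
    unfold Holds at this
    rw [← this]
    congr 1
    ext <;> simp

lemma holds_exF_of {B X Y : E} (φ : B ⊗ X ⟶ Om E) (f : Y ⟶ X) (b : Y ⟶ B)
    (h : Holds (lift b f ≫ φ)) : Holds (f ≫ exF φ) := by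
  unfold exF
  rw [holds_allF]
  intro Z g ω
  rw [holds_impF]
  intro W k hk
  rw [← Category.assoc, holds_allF] at hk
  have h1 := hk (𝟙 W) (k ≫ g ≫ b)
  have h2 := (holds_impF _ _ _).1 h1 (𝟙 W)
  have e1 : lift (k ≫ g ≫ b) (𝟙 W ≫ k ≫ lift ω (g ≫ f)) ≫ snd B _ ≫ fst (Om E) X =
      k ≫ lift ω (g ≫ f) ≫ fst _ _ := by simp
  have e2 : lift (k ≫ g ≫ b) (𝟙 W ≫ k ≫ lift ω (g ≫ f)) ≫ B ◁ snd (Om E) X ≫ φ =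
      (k ≫ g) ≫ lift b f ≫ φ := by
    simp only [← Category.assoc]
    congr 1
    ext <;> simp
  rw [e1, e2, Category.id_comp, Category.id_comp] at h2
  exact h2 (h.comp _)

lemma holds_exF_elim {B X Y : E} (φ : B ⊗ X ⟶ Om E) (f : Y ⟶ X) (ψ : Y ⟶ Om E)
    (h : Holds (f ≫ exF φ))
    (hψ : ∀ {Z : E} (g : Z ⟶ Y) (b : Z ⟶ B), Holds (lift b (g ≫ f) ≫ φ) → Holds (g ≫ ψ)) :
    Holds ψ := by
  unfold exF at h
  rw [holds_allF] at h
  have h1 := (holds_impF _ _ _).1 (h (𝟙 Y) ψ) (𝟙 Y)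
  simp only [Category.id_comp, lift_fst] at h1
  apply h1
  rw [holds_allF]
  intro Z g b
  rw [holds_impF]
  intro W k hk
  have e1 : k ≫ lift b (g ≫ lift ψ f) ≫ snd B _ ≫ fst (Om E) X = (k ≫ g) ≫ ψ := by simp
  have e2 : k ≫ lift b (g ≫ lift ψ f) ≫ B ◁ snd (Om E) X ≫ φ =
      lift (k ≫ b) ((k ≫ g) ≫ f) ≫ φ := by
    simp only [← Category.assoc]
    congr 1
    ext <;> simp
  rw [e1]
  rw [e2] at hk
  exact hψ _ _ hk

end InternalLogic

section Quantale

/-- An internal commutative quantale of the topos `E`: a commutative monoid object with an internal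
partial order `le : Q × Q ⟶ Ω` and a join operation `sup : P(Q) ⟶ Q` over which multiplication
distributes. The axioms are the interpretations, on generalized elements at all stages, of the
corresponding formulas of the internal language. -/
structure CommQuantale (E : Type u) [Category.{v} E] [CartesianMonoidalCategory E]
    [BraidedCategory E] [MonoidalClosed E] [HasSubobjectClassifier E] where
  /-- The underlying object. -/
  carrier : E
  /-- The monoid structure. -/
  [mon : MonObj carrier]
  [comm : IsCommMonObj carrier]
  /-- The order relation. -/
  le : carrier ⊗ carrier ⟶ Om E
  le_refl : ∀ {X : E} (x : X ⟶ carrier), Holds (lift x x ≫ le)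
  le_trans : ∀ {X : E} (x y z : X ⟶ carrier),
    Holds (lift x y ≫ le) → Holds (lift y z ≫ le) → Holds (lift x z ≫ le)
  le_antisymm : ∀ {X : E} (x y : X ⟶ carrier),
    Holds (lift x y ≫ le) → Holds (lift y x ≫ le) → x = y
  /-- The join of a subset. -/
  sup : PowObj carrier ⟶ carrier
  /-- `⋁ S` is the least upper bound of `S`. -/
  sup_le_iff : ∀ {X : E} (S : X ⟶ PowObj carrier) (t : X ⟶ carrier),
    Holds (lift (S ≫ sup) t ≫ le) ↔
      ∀ {Y : E} (f : Y ⟶ X) (s : Y ⟶ carrier), Mem s (f ≫ S) → Holds (lift s (f ≫ t) ≫ le)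
  /-- `q ⊗ ⋁ S` is the least upper bound of `{q ⊗ s | s ∈ S}`. -/
  mul_sup_le_iff : ∀ {X : E} (q : X ⟶ carrier) (S : X ⟶ PowObj carrier) (t : X ⟶ carrier),
    Holds (lift (q * (S ≫ sup)) t ≫ le) ↔
      ∀ {Y : E} (f : Y ⟶ X) (s : Y ⟶ carrier), Mem s (f ≫ S) →
        Holds (lift ((f ≫ q) * s) (f ≫ t) ≫ le)

attribute [instance] CommQuantale.mon CommQuantale.comm

variable {E : Type u} [Category.{v} E] [CartesianMonoidalCategory E] [BraidedCategory E]
  [MonoidalClosed E] [HasSubobjectClassifier E]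

namespace CommQuantale

/-- The order on generalized elements of an internal quantale. -/
def Le (Q : CommQuantale E) {X : E} (x y : X ⟶ Q.carrier) : Prop := Holds (lift x y ≫ Q.le)

/-- A morphism of internal commutative quantales: a homomorphism of monoid objects that preserves
joins, i.e. `h(⋁ S)` is the least upper bound of `{h(s) | s ∈ S}`. -/
@[ext]
structure Hom (Q₁ Q₂ : CommQuantale E) where
  /-- The underlying morphism. -/
  hom : Q₁.carrier ⟶ Q₂.carrier
  one_hom : MonObj.one ≫ hom = MonObj.one
  mul_hom : MonObj.mul ≫ hom = (hom ⊗ₘ hom) ≫ MonObj.mul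
  sup_hom_le_iff : ∀ {X : E} (S : X ⟶ PowObj Q₁.carrier) (t : X ⟶ Q₂.carrier),
    Q₂.Le ((S ≫ Q₁.sup) ≫ hom) t ↔
      ∀ {Y : E} (f : Y ⟶ X) (s : Y ⟶ Q₁.carrier), Mem s (f ≫ S) → Q₂.Le (s ≫ hom) (f ≫ t)

variable {Q : CommQuantale E}

lemma Le.refl {X : E} (x : X ⟶ Q.carrier) : Q.Le x x := Q.le_refl x

lemma Le.trans {X : E} {x y z : X ⟶ Q.carrier} (h : Q.Le x y) (h' : Q.Le y z) : Q.Le x z :=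
  Q.le_trans _ _ _ h h'

lemma Le.antisymm {X : E} {x y : X ⟶ Q.carrier} (h : Q.Le x y) (h' : Q.Le y x) : x = y :=
  Q.le_antisymm _ _ h h'

variable [HasFiniteLimits E]

lemma Le.comp {X Y : E} {x y : X ⟶ Q.carrier} (h : Q.Le x y) (f : Y ⟶ X) :
    Q.Le (f ≫ x) (f ≫ y) := by
  have := Holds.comp h f
  unfold Le
  rwa [← Category.assoc, comp_lift] at this

lemma eq_of_le_iff {X : E} {x y : X ⟶ Q.carrier} (h : ∀ t, Q.Le x t ↔ Q.Le y t) : x = y :=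
  Le.antisymm ((h y).2 (Le.refl y)) ((h x).1 (Le.refl x))

/-- The principal down-set `{z | z ≤ y}`. -/
def down (Q : CommQuantale E) {X : E} (y : X ⟶ Q.carrier) : X ⟶ PowObj Q.carrier :=
  setOfF (lift (fst _ X) (snd _ X ≫ y) ≫ Q.le)

lemma mem_down {X Y : E} (y : X ⟶ Q.carrier) (f : Y ⟶ X) (z : Y ⟶ Q.carrier) :
    Mem z (f ≫ Q.down y) ↔ Q.Le z (f ≫ y) := by
  unfold down
  rw [mem_setOfF, ← Category.assoc, comp_lift, lift_fst, lift_snd_assoc]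
  rfl

lemma sup_down {X : E} (y : X ⟶ Q.carrier) : Q.down y ≫ Q.sup = y := by
  apply eq_of_le_iff
  intro t
  refine (Q.sup_le_iff _ _).trans ⟨fun h => ?_, fun h Y f s hs => ?_⟩
  · have := h (𝟙 X) y ((mem_down _ _ _).2 (by rw [Category.id_comp]; exact Le.refl _))
    rwa [Category.id_comp] at this
  · exact Le.trans ((mem_down _ _ _).1 hs) (Le.comp h f)

lemma mul_le_mul_left' {X : E} (q : X ⟶ Q.carrier) {x y : X ⟶ Q.carrier} (h : Q.Le x y) :
    Q.Le (q * x) (q * y) := by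
  have := (Q.mul_sup_le_iff q (Q.down y) (q * y)).1 (by rw [sup_down]; exact Le.refl _)
    (𝟙 X) x ((mem_down _ _ _).2 (by rwa [Category.id_comp]))
  rwa [Category.id_comp, Category.id_comp] at this

lemma Le.mul {X : E} {x y x' y' : X ⟶ Q.carrier} (h : Q.Le x y) (h' : Q.Le x' y') :
    Q.Le (x * x') (y * y') := by
  refine Le.trans (mul_le_mul_left' x h') ?_
  rw [mul_comm x, mul_comm y]
  exact mul_le_mul_left' y' h

lemma Le.prod {X : E} {n : ℕ} {x y : Fin n → (X ⟶ Q.carrier)} (h : ∀ i, Q.Le (x i) (y i)) :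
    Q.Le (∏ i, x i) (∏ i, y i) := by
  induction n with
  | zero => simpa using Le.refl _
  | succ n ih =>
    rw [Fin.prod_univ_succ, Fin.prod_univ_succ]
    exact Le.mul (h 0) (ih fun i => h i.succ)

lemma comp_prod {X Y : E} {n : ℕ} (f : Y ⟶ X) (x : Fin n → (X ⟶ Q.carrier)) :
    f ≫ (∏ i, x i) = ∏ i, f ≫ x i := by
  induction n with
  | zero => simp [MonObj.comp_one]
  | succ n ih => rw [Fin.prod_univ_succ, Fin.prod_univ_succ, MonObj.comp_mul, ih]

lemma Hom.mono {Q₁ Q₂ : CommQuantale E} (h : Hom Q₁ Q₂) {X : E} {x y : X ⟶ Q₁.carrier}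
    (hxy : Q₁.Le x y) : Q₂.Le (x ≫ h.hom) (y ≫ h.hom) := by
  have := (h.sup_hom_le_iff (Q₁.down y) (y ≫ h.hom)).1 (by rw [sup_down]; exact Le.refl _)
    (𝟙 X) x ((mem_down _ _ _).2 (by rwa [Category.id_comp]))
  simpa only [Category.id_comp] using this

/-- The identity morphism of an internal quantale. -/
def Hom.id (Q : CommQuantale E) : Hom Q Q where
  hom := 𝟙 _
  one_hom := Category.comp_id _
  mul_hom := by simp
  sup_hom_le_iff S t := by
    simp only [Category.comp_id]
    exact Q.sup_le_iff S t

/-- The composite of two morphisms of internal quantales. -/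
def Hom.comp {Q₁ Q₂ Q₃ : CommQuantale E} (h : Hom Q₁ Q₂) (k : Hom Q₂ Q₃) : Hom Q₁ Q₃ where
  hom := h.hom ≫ k.hom
  one_hom := by rw [← Category.assoc, h.one_hom, k.one_hom]
  mul_hom := by
    rw [← Category.assoc, h.mul_hom, Category.assoc, k.mul_hom, ← Category.assoc,
      tensorHom_comp_tensorHom]
  sup_hom_le_iff {X} S t := by
    simp only [← Category.assoc]
    constructor
    · intro H Y f s hs
      have h1 := (h.sup_hom_le_iff S _).1 (Le.refl _) f s hs
      have h2 := k.mono h1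
      refine Le.trans h2 ?_
      have := Le.comp H f
      simpa only [Category.assoc] using this
    · intro H
      let T : X ⟶ PowObj Q₂.carrier :=
        setOfF (lift (fst _ X ≫ k.hom) (snd _ X ≫ t) ≫ Q₃.le)
      have hT : ∀ {Y : E} (f : Y ⟶ X) (z : Y ⟶ Q₂.carrier),
          Mem z (f ≫ T) ↔ Q₃.Le (z ≫ k.hom) (f ≫ t) := by
        intro Y f z
        rw [mem_setOfF, ← Category.assoc, comp_lift, lift_fst_assoc, lift_snd_assoc]
        rfl
      have h1 : Q₂.Le ((S ≫ Q₁.sup) ≫ h.hom) (T ≫ Q₂.sup) := by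
        rw [h.sup_hom_le_iff]
        intro Y f s hs
        have := (Q₂.sup_le_iff T _).1 (Le.refl _) f (s ≫ h.hom) ((hT _ _).2 (H f s hs))
        exact this
      refine Le.trans (k.mono h1) ?_
      rw [k.sup_hom_le_iff]
      intro Y f s hs
      exact (hT _ _).1 hs

/-- Internal commutative quantales and their morphisms form a category. -/
instance : Category (CommQuantale E) where
  Hom := Hom
  id := Hom.id
  comp := Hom.comp
  id_comp _ := Hom.ext (Category.id_comp _)
  comp_id _ := Hom.ext (Category.comp_id _)
  assoc _ _ _ := Hom.ext (Category.assoc _ _ _)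

/-- The join `⋁ {f(b, x) | b : B} = ⋁ {q | ∃ b : B, q = f(b, x)}` in context `X`. -/
def iSup (Q : CommQuantale E) {B X : E} (f : B ⊗ X ⟶ Q.carrier) : X ⟶ Q.carrier :=
  setOfF (A := Q.carrier) (X := X)
    (exF (B := B) (X := Q.carrier ⊗ X)
      (eqF (snd B (Q.carrier ⊗ X) ≫ fst Q.carrier X)
        (lift (fst B (Q.carrier ⊗ X)) (snd B (Q.carrier ⊗ X) ≫ snd Q.carrier X) ≫ f))) ≫ Q.sup

/-- The join `⋁ {k | φ(x)} = ⋁ {q | q = k ∧ φ(x)}` in context `X`, where `k` is the unit. -/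
def guard (Q : CommQuantale E) {X : E} (φ : X ⟶ Om E) : X ⟶ Q.carrier :=
  setOfF (A := Q.carrier) (X := X)
    (andF (eqF (fst Q.carrier X) 1) (snd Q.carrier X ≫ φ)) ≫ Q.sup

lemma mul_iSup_le_iff {B X Y : E} (f : B ⊗ X ⟶ Q.carrier) (g : Y ⟶ X) (u t : Y ⟶ Q.carrier) :
    Q.Le (u * (g ≫ Q.iSup f)) t ↔ ∀ {Z : E} (h : Z ⟶ Y) (b : Z ⟶ B),
      Q.Le ((h ≫ u) * (lift b (h ≫ g) ≫ f)) (h ≫ t) := by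
  unfold iSup
  rw [← Category.assoc]
  refine (Q.mul_sup_le_iff u _ t).trans ⟨fun H Z h b => ?_, fun H Z h s hs => ?_⟩
  · apply H h
    rw [← Category.assoc, mem_setOfF]
    apply holds_exF_of _ _ b
    rw [holds_eqF]
    simp [← Category.assoc, comp_lift]
  · rw [← Category.assoc, mem_setOfF] at hs
    refine holds_exF_elim _ _ _ hs ?_
    intro W k b hb
    rw [holds_eqF] at hb
    have e : k ≫ s = lift b ((k ≫ h) ≫ g) ≫ f := by
      have e1 : lift b (k ≫ lift s (h ≫ g)) ≫ snd B (Q.carrier ⊗ X) ≫ fst Q.carrier X = k ≫ s := by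
        simp
      rw [← e1, hb, ← Category.assoc]
      congr 1
      ext <;> simp
    have := H (k ≫ h) b
    rw [← e] at this
    unfold Le at this
    rw [← Category.assoc, comp_lift, MonObj.comp_mul]
    simpa only [Category.assoc] using this

lemma mul_guard_le_iff {X Y : E} (φ : X ⟶ Om E) (g : Y ⟶ X) (u t : Y ⟶ Q.carrier) :
    Q.Le (u * (g ≫ Q.guard φ)) t ↔ ∀ {Z : E} (h : Z ⟶ Y), Holds (h ≫ g ≫ φ) →
      Q.Le (h ≫ u) (h ≫ t) := by
  unfold guard
  rw [← Category.assoc]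
  refine (Q.mul_sup_le_iff u _ t).trans ⟨fun H Z h hφ => ?_, fun H Z h s hs => ?_⟩
  · have := H h 1 ?_
    · rw [mul_one] at this; exact this
    rw [← Category.assoc, mem_setOfF, holds_andF, holds_eqF]
    simp only [lift_fst, MonObj.comp_one, true_and, lift_snd_assoc]
    simpa only [Category.assoc] using hφ
  · rw [← Category.assoc, mem_setOfF, holds_andF, holds_eqF] at hs
    simp only [lift_fst, MonObj.comp_one, lift_snd_assoc, Category.assoc] at hs
    rw [hs.1, mul_one]
    exact H h hs.2

lemma iSup_le_iff {B X Y : E} (f : B ⊗ X ⟶ Q.carrier) (g : Y ⟶ X) (t : Y ⟶ Q.carrier) :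
    Q.Le (g ≫ Q.iSup f) t ↔ ∀ {Z : E} (h : Z ⟶ Y) (b : Z ⟶ B),
      Q.Le (lift b (h ≫ g) ≫ f) (h ≫ t) := by
  have := mul_iSup_le_iff f g 1 t
  simpa only [one_mul, MonObj.comp_one] using this

lemma guard_le_iff {X Y : E} (φ : X ⟶ Om E) (g : Y ⟶ X) (t : Y ⟶ Q.carrier) :
    Q.Le (g ≫ Q.guard φ) t ↔ ∀ {Z : E} (h : Z ⟶ Y), Holds (h ≫ g ≫ φ) →
      Q.Le 1 (h ≫ t) := by
  have := mul_guard_le_iff φ g 1 t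
  simpa only [one_mul, MonObj.comp_one] using this

end CommQuantale

end Quantale

section Relations

variable {E : Type u} [Category.{v} E] [CartesianMonoidalCategory E] [BraidedCategory E]
  [HasFiniteLimits E] [MonoidalClosed E] [HasSubobjectClassifier E]

namespace CommQuantale

variable (Q : CommQuantale E)

/-- The graph `f_∘(a, b) = ⋁ {k | f(a) = b}` of a morphism. -/
def graph {A B : E} (f : A ⟶ B) : A ⊗ B ⟶ Q.carrier := Q.guard (eqF (fst A B ≫ f) (snd A B))

/-- The identity relation `1_A(a₁, a₂) = ⋁ {k | a₁ = a₂}`. -/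
def relId (A : E) : A ⊗ A ⟶ Q.carrier := Q.guard (eqF (fst A A) (snd A A))

variable {Q}

/-- The composite relation `(S ∘ R)(a, c) = ⋁ {R(a, b) ⊗ S(b, c) | b : B}`. -/
def relComp {A B C : E} (R : A ⊗ B ⟶ Q.carrier) (S : B ⊗ C ⟶ Q.carrier) : A ⊗ C ⟶ Q.carrier :=
  Q.iSup (B := B) (X := A ⊗ C)
    ((lift (snd B (A ⊗ C) ≫ fst A C) (fst B (A ⊗ C)) ≫ R) *
      (lift (fst B (A ⊗ C)) (snd B (A ⊗ C) ≫ snd A C) ≫ S))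

/-- The tensor `(R ⊗ R')((a, a'), (b, b')) = R(a, b) ⊗ R'(a', b')` of relations. -/
def relTensor {A A' B B' : E} (R : A ⊗ B ⟶ Q.carrier) (R' : A' ⊗ B' ⟶ Q.carrier) :
    (A ⊗ A') ⊗ (B ⊗ B') ⟶ Q.carrier :=
  (lift (fst (A ⊗ A') (B ⊗ B') ≫ fst A A') (snd (A ⊗ A') (B ⊗ B') ≫ fst B B') ≫ R) *
    (lift (fst (A ⊗ A') (B ⊗ B') ≫ snd A A') (snd (A ⊗ A') (B ⊗ B') ≫ snd B B') ≫ R')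

lemma rel_ext {A B : E} {R S : A ⊗ B ⟶ Q.carrier}
    (h : ∀ {X : E} (a : X ⟶ A) (b : X ⟶ B), lift a b ≫ R = lift a b ≫ S) : R = S := by
  have := h (fst A B) (snd A B)
  simpa using this

lemma relId_eq_graph (A : E) : Q.relId A = Q.graph (𝟙 A) := by
  unfold relId graph
  rw [Category.comp_id]

lemma mul_graph_le_iff {A B X : E} (f : A ⟶ B) (a : X ⟶ A) (b : X ⟶ B) (u t : X ⟶ Q.carrier) :
    Q.Le (u * (lift a b ≫ Q.graph f)) t ↔ ∀ {Z : E} (h : Z ⟶ X), h ≫ a ≫ f = h ≫ b →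
      Q.Le (h ≫ u) (h ≫ t) := by
  unfold graph
  rw [mul_guard_le_iff]
  refine forall_congr' fun Z => forall_congr' fun h => ?_
  rw [← Category.assoc, holds_eqF]
  simp

lemma graph_le_iff {A B X : E} (f : A ⟶ B) (a : X ⟶ A) (b : X ⟶ B) (t : X ⟶ Q.carrier) :
    Q.Le (lift a b ≫ Q.graph f) t ↔ ∀ {Z : E} (h : Z ⟶ X), h ≫ a ≫ f = h ≫ b →
      Q.Le 1 (h ≫ t) := by
  have := mul_graph_le_iff f a b 1 t
  simpa only [one_mul, MonObj.comp_one] using this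

lemma one_le_graph {A B X : E} (f : A ⟶ B) (a : X ⟶ A) (b : X ⟶ B) (h : a ≫ f = b) :
    Q.Le 1 (lift a b ≫ Q.graph f) := by
  have := (graph_le_iff f a b _).1 (Le.refl (Q := Q) _) (𝟙 X) (by simpa using h)
  simpa only [Category.id_comp] using this

lemma mul_relComp_le_iff {A B C X : E} (R : A ⊗ B ⟶ Q.carrier) (S : B ⊗ C ⟶ Q.carrier)
    (a : X ⟶ A) (c : X ⟶ C) (u t : X ⟶ Q.carrier) :
    Q.Le (u * (lift a c ≫ relComp R S)) t ↔ ∀ {Z : E} (h : Z ⟶ X) (b : Z ⟶ B),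
      Q.Le ((h ≫ u) * ((lift (h ≫ a) b ≫ R) * (lift b (h ≫ c) ≫ S))) (h ≫ t) := by
  unfold relComp
  rw [mul_iSup_le_iff]
  refine forall_congr' fun Z => forall_congr' fun h => forall_congr' fun b => ?_
  rw [MonObj.comp_mul, ← Category.assoc, ← Category.assoc]
  simp only [comp_lift, lift_fst, lift_snd_assoc, lift_snd]

lemma relComp_le_iff {A B C X : E} (R : A ⊗ B ⟶ Q.carrier) (S : B ⊗ C ⟶ Q.carrier)
    (a : X ⟶ A) (c : X ⟶ C) (t : X ⟶ Q.carrier) :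
    Q.Le (lift a c ≫ relComp R S) t ↔ ∀ {Z : E} (h : Z ⟶ X) (b : Z ⟶ B),
      Q.Le ((lift (h ≫ a) b ≫ R) * (lift b (h ≫ c) ≫ S)) (h ≫ t) := by
  have := mul_relComp_le_iff R S a c 1 t
  simpa only [one_mul, MonObj.comp_one] using this

lemma le_relComp {A B C X : E} (R : A ⊗ B ⟶ Q.carrier) (S : B ⊗ C ⟶ Q.carrier)
    (a : X ⟶ A) (b : X ⟶ B) (c : X ⟶ C) :
    Q.Le ((lift a b ≫ R) * (lift b c ≫ S)) (lift a c ≫ relComp R S) := by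
  have := (relComp_le_iff R S a c _).1 (Le.refl _) (𝟙 X) b
  simpa only [Category.id_comp] using this

lemma lift_relTensor {A A' B B' X : E} (R : A ⊗ B ⟶ Q.carrier) (R' : A' ⊗ B' ⟶ Q.carrier)
    (a : X ⟶ A ⊗ A') (b : X ⟶ B ⊗ B') :
    lift a b ≫ relTensor R R' =
      (lift (a ≫ fst A A') (b ≫ fst B B') ≫ R) * (lift (a ≫ snd A A') (b ≫ snd B B') ≫ R') := by
  unfold relTensor
  rw [MonObj.comp_mul, ← Category.assoc, ← Category.assoc]
  simp only [comp_lift, lift_fst_assoc, lift_snd_assoc]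

lemma relComp_assoc {A B C D : E} (R : A ⊗ B ⟶ Q.carrier) (S : B ⊗ C ⟶ Q.carrier)
    (T : C ⊗ D ⟶ Q.carrier) : relComp (relComp R S) T = relComp R (relComp S T) := by
  apply rel_ext
  intro X a d
  apply eq_of_le_iff
  intro t
  rw [relComp_le_iff, relComp_le_iff]
  constructor
  · intro H Z h b
    rw [mul_relComp_le_iff]
    intro W k c
    have := H (k ≫ h) c
    rw [mul_comm, mul_relComp_le_iff] at this
    have := this (𝟙 W) (k ≫ b)
    simp only [Category.id_comp, Category.assoc] at this
    rw [← Category.assoc, comp_lift]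
    convert this using 1
    ac_rfl
  · intro H Z h c
    rw [mul_comm, mul_relComp_le_iff]
    intro W k b
    have := H (k ≫ h) b
    rw [mul_relComp_le_iff] at this
    have := this (𝟙 W) (k ≫ c)
    simp only [Category.id_comp, Category.assoc] at this
    rw [← Category.assoc, comp_lift]
    convert this using 1
    ac_rfl

lemma graph_relComp {A B C X : E} (f : A ⟶ B) (S : B ⊗ C ⟶ Q.carrier) (a : X ⟶ A) (c : X ⟶ C) :
    lift a c ≫ relComp (Q.graph f) S = lift (a ≫ f) c ≫ S := by
  apply Le.antisymm
  · rw [relComp_le_iff]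
    intro Z h b
    rw [mul_comm, mul_graph_le_iff]
    intro W k e
    simp only [← Category.assoc, comp_lift] at e ⊢
    rw [e]
    exact Le.refl _
  · refine Le.trans ?_ (le_relComp _ _ a (a ≫ f) c)
    have := Le.mul (one_le_graph (Q := Q) f a (a ≫ f) rfl) (Le.refl (lift (a ≫ f) c ≫ S))
    rwa [one_mul] at this

lemma relComp_graph {A B C X : E} (R : A ⊗ B ⟶ Q.carrier) (f : B ≅ C) (a : X ⟶ A) (c : X ⟶ C) :
    lift a c ≫ relComp R (Q.graph f.hom) = lift a (c ≫ f.inv) ≫ R := by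
  apply Le.antisymm
  · rw [relComp_le_iff]
    intro Z h b
    rw [mul_graph_le_iff]
    intro W k e
    have e' : k ≫ b = k ≫ h ≫ c ≫ f.inv := by
      have := congrArg (· ≫ f.inv) e
      simpa using this
    simp only [← Category.assoc, comp_lift] at e' ⊢
    rw [e']
    exact Le.refl _
  · refine Le.trans ?_ (le_relComp _ _ a (c ≫ f.inv) c)
    have := Le.mul (Le.refl (lift a (c ≫ f.inv) ≫ R))
      (one_le_graph (Q := Q) f.hom (c ≫ f.inv) c (by simp))
    rwa [mul_one] at this

lemma graph_comp_graph {A B C : E} (f : A ⟶ B) (g : B ⟶ C) :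
    relComp (Q.graph f) (Q.graph g) = Q.graph (f ≫ g) := by
  apply rel_ext
  intro X a c
  rw [graph_relComp]
  apply eq_of_le_iff
  intro t
  rw [graph_le_iff, graph_le_iff]
  simp only [Category.assoc]

lemma graph_tensor_graph {A A' B B' : E} (f : A ⟶ B) (g : A' ⟶ B') :
    relTensor (Q.graph f) (Q.graph g) = Q.graph (f ⊗ₘ g) := by
  apply rel_ext
  intro X a b
  rw [lift_relTensor]
  apply eq_of_le_iff
  intro t
  rw [mul_graph_le_iff, graph_le_iff]
  constructor
  · intro H Z h e
    have e1 := congrArg (· ≫ fst _ _) e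
    have e2 := congrArg (· ≫ snd _ _) e
    have := H h (by simpa using e2)
    rw [← Category.assoc, comp_lift, graph_le_iff] at this
    have := this (𝟙 Z) (by simpa using e1)
    simpa only [Category.id_comp] using this
  · intro H Z h e
    rw [← Category.assoc, comp_lift, graph_le_iff]
    intro W k e'
    have := H (k ≫ h) (by
      have e2 := congrArg (k ≫ ·) e
      ext
      · simpa using e'
      · simpa using e2)
    simpa only [Category.assoc] using this

lemma id_relComp {A B : E} (R : A ⊗ B ⟶ Q.carrier) : relComp (Q.relId A) R = R := by
  rw [relId_eq_graph]
  apply rel_ext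
  intro X a b
  rw [graph_relComp, Category.comp_id]

lemma relComp_id {A B : E} (R : A ⊗ B ⟶ Q.carrier) : relComp R (Q.relId B) = R := by
  rw [relId_eq_graph]
  apply rel_ext
  intro X a b
  have := relComp_graph R (Iso.refl B) a b
  simpa using this

lemma relTensor_comp {A₁ B₁ C₁ A₂ B₂ C₂ : E} (R₁ : A₁ ⊗ B₁ ⟶ Q.carrier)
    (R₂ : A₂ ⊗ B₂ ⟶ Q.carrier) (S₁ : B₁ ⊗ C₁ ⟶ Q.carrier) (S₂ : B₂ ⊗ C₂ ⟶ Q.carrier) :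
    relComp (relTensor R₁ R₂) (relTensor S₁ S₂) = relTensor (relComp R₁ S₁) (relComp R₂ S₂) := by
  apply rel_ext
  intro X a c
  rw [lift_relTensor]
  apply eq_of_le_iff
  intro t
  rw [relComp_le_iff, mul_relComp_le_iff]
  constructor
  · intro H Z h b₂
    rw [← Category.assoc, comp_lift, mul_comm, mul_relComp_le_iff]
    intro W k b₁
    have := H (k ≫ h) (lift b₁ (k ≫ b₂))
    rw [lift_relTensor, lift_relTensor] at this
    simp only [lift_fst, lift_snd, Category.assoc] at this
    simp only [MonObj.comp_mul, ← Category.assoc, comp_lift] at this ⊢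
    convert this using 1
    ac_rfl
  · intro H Z h b
    have := H h (b ≫ snd _ _)
    rw [← Category.assoc, comp_lift, mul_comm, mul_relComp_le_iff] at this
    have := this (𝟙 Z) (b ≫ fst _ _)
    rw [lift_relTensor, lift_relTensor]
    simp only [Category.id_comp] at this
    simp only [← Category.assoc] at this ⊢
    convert this using 1
    ac_rfl

lemma relComp_mono {A B C : E} {R R' : A ⊗ B ⟶ Q.carrier} {S S' : B ⊗ C ⟶ Q.carrier}
    (h : Q.Le R R') (h' : Q.Le S S') : Q.Le (relComp R S) (relComp R' S') := by
  have : Q.Le (lift (fst A C) (snd A C) ≫ relComp R S)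
      (lift (fst A C) (snd A C) ≫ relComp R' S') := by
    rw [relComp_le_iff]
    intro Z k b
    refine Le.trans (Le.mul (h.comp _) (h'.comp _)) ?_
    rw [← Category.assoc, comp_lift]
    exact le_relComp _ _ _ _ _
  simpa using this

lemma relTensor_mono {A B A' B' : E} {R S : A ⊗ B ⟶ Q.carrier} {R' S' : A' ⊗ B' ⟶ Q.carrier}
    (h : Q.Le R S) (h' : Q.Le R' S') : Q.Le (relTensor R R') (relTensor S S') :=
  Le.mul (h.comp _) (h'.comp _)

lemma prod_relComp_le {A B C : E} (R : A ⊗ B ⟶ Q.carrier) (S : B ⊗ C ⟶ Q.carrier) :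
    ∀ {n : ℕ} {X : E} (a : Fin n → (X ⟶ A)) (c : Fin n → (X ⟶ C)) (u t : X ⟶ Q.carrier),
      (∀ {Z : E} (h : Z ⟶ X) (b : Fin n → (Z ⟶ B)),
        Q.Le ((h ≫ u) * ∏ i, ((lift (h ≫ a i) (b i) ≫ R) * (lift (b i) (h ≫ c i) ≫ S)))
          (h ≫ t)) →
      Q.Le (u * ∏ i, (lift (a i) (c i) ≫ relComp R S)) t := by
  intro n
  induction n with
  | zero =>
    intro X a c u t H
    have := H (𝟙 X) (fun i => i.elim0)
    simpa using this
  | succ n ih =>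
    intro X a c u t H
    rw [Fin.prod_univ_succ, mul_left_comm, mul_comm, mul_relComp_le_iff]
    intro Z h b₀
    rw [MonObj.comp_mul, comp_prod, mul_right_comm]
    simp only [← Category.assoc, comp_lift]
    apply ih
    intro W k b
    have := H (k ≫ h) (Fin.cons (k ≫ b₀) b)
    rw [Fin.prod_univ_succ] at this
    simp only [Fin.cons_zero, Fin.cons_succ] at this
    simp only [MonObj.comp_mul, ← Category.assoc, comp_lift] at this ⊢
    rwa [← mul_assoc] at this

lemma prod_graph_le {A B : E} (f : A ⟶ B) :
    ∀ {n : ℕ} {X : E} (a : Fin n → (X ⟶ A)) (b : Fin n → (X ⟶ B)) (u t : X ⟶ Q.carrier),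
      (∀ {Z : E} (h : Z ⟶ X), (∀ i, h ≫ a i ≫ f = h ≫ b i) → Q.Le (h ≫ u) (h ≫ t)) →
      Q.Le (u * ∏ i, (lift (a i) (b i) ≫ Q.graph f)) t := by
  intro n
  induction n with
  | zero =>
    intro X a c u t H
    have := H (𝟙 X) (fun i => i.elim0)
    simpa using this
  | succ n ih =>
    intro X a b u t H
    rw [Fin.prod_univ_succ, mul_left_comm, mul_comm, mul_graph_le_iff]
    intro Z h e
    rw [MonObj.comp_mul, comp_prod]
    simp only [← Category.assoc, comp_lift]
    apply ih
    intro W k e'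
    have := H (k ≫ h) (Fin.cases (by simpa using congrArg (k ≫ ·) e)
      (fun i => by simpa using e' i))
    simpa only [Category.assoc] using this

end CommQuantale

end Relations

section Algebras

/-- An algebraic signature: a set of operation symbols of finite arity. -/
structure Signature where
  /-- The operation symbols. -/
  Op : Type w
  /-- The arity of an operation symbol. -/
  arity : Op → ℕ

/-- Terms over a signature in the variables `x₀, …, xₙ₋₁`. -/
inductive Term (S : Signature.{w}) (n : ℕ) : Type w
  | var (i : Fin n) : Term S n
  | app (σ : S.Op) (args : Fin (S.arity σ) → Term S n) : Term S n

/-- A presentation `(Σ, E)` of an algebraic variety: a signature with a set of equations, each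
between two terms in the same finite context of variables. -/
structure Variety extends Signature.{w} where
  /-- The equations. -/
  eqns : Set (Σ n : ℕ, Term toSignature n × Term toSignature n)

variable {E : Type u} [Category.{v} E] [CartesianMonoidalCategory E] [HasFiniteProducts E]

/-- The value of a term on generalized elements, for an interpretation `op` of the operations. -/
def Term.eval {S : Signature.{w}} {A : E}
    (op : ∀ σ : S.Op, (∏ᶜ fun _ : Fin (S.arity σ) => A) ⟶ A) {X : E} {n : ℕ}
    (ρ : Fin n → (X ⟶ A)) : Term S n → (X ⟶ A)
  | .var i => ρ i
  | .app σ args => Pi.lift (fun i => (args i).eval op ρ) ≫ op σ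

/-- A `(Σ, E)`-algebra in the category `E`. -/
structure Algebra (V : Variety.{w}) (E : Type u) [Category.{v} E] [HasFiniteProducts E] where
  /-- The underlying object. -/
  carrier : E
  /-- The operations `Aⁿ ⟶ A`. -/
  op : ∀ σ : V.Op, (∏ᶜ fun _ : Fin (V.arity σ) => carrier) ⟶ carrier
  sat : ∀ e ∈ V.eqns, ∀ {X : E} (ρ : Fin e.1 → (X ⟶ carrier)),
    Term.eval op ρ e.2.1 = Term.eval op ρ e.2.2

namespace Algebra

variable {V : Variety.{w}}

/-- The value `σ(a₁, …, aₙ)` of an operation on generalized elements. -/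
def ap (A : Algebra V E) (σ : V.Op) {X : E} (a : Fin (V.arity σ) → (X ⟶ A.carrier)) :
    X ⟶ A.carrier := Pi.lift a ≫ A.op σ

lemma comp_ap (A : Algebra V E) (σ : V.Op) {X Y : E} (f : Y ⟶ X)
    (a : Fin (V.arity σ) → (X ⟶ A.carrier)) : f ≫ A.ap σ a = A.ap σ (fun i => f ≫ a i) := by
  unfold ap
  rw [← Category.assoc]
  congr 1
  apply Pi.hom_ext
  intro i
  simp

/-- A morphism of the underlying objects that is a homomorphism of algebras. -/
def IsHom (A B : Algebra V E) (f : A.carrier ⟶ B.carrier) : Prop :=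
  ∀ (σ : V.Op) {X : E} (a : Fin (V.arity σ) → (X ⟶ A.carrier)),
    A.ap σ a ≫ f = B.ap σ (fun i => a i ≫ f)

lemma eval_comp {S : Signature.{w}} {A B : E}
    (opA : ∀ σ : S.Op, (∏ᶜ fun _ : Fin (S.arity σ) => A) ⟶ A)
    (opB : ∀ σ : S.Op, (∏ᶜ fun _ : Fin (S.arity σ) => B) ⟶ B) (f : A ⟶ B)
    (hf : ∀ (σ : S.Op) {X : E} (a : Fin (S.arity σ) → (X ⟶ A)),
      (Pi.lift a ≫ opA σ) ≫ f = Pi.lift (fun i => a i ≫ f) ≫ opB σ)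
    {X : E} {n : ℕ} (ρ : Fin n → (X ⟶ A)) (t : Term S n) :
    t.eval opA ρ ≫ f = t.eval opB (fun i => ρ i ≫ f) := by
  induction t with
  | var i => rfl
  | app σ args ih =>
    simp only [Term.eval]
    rw [hf]
    simp only [ih]

/-- The product of two algebras, with componentwise operations. -/
abbrev prod (A B : Algebra V E) : Algebra V E where
  carrier := A.carrier ⊗ B.carrier
  op σ := lift (Pi.lift (fun i => Pi.π _ i ≫ fst A.carrier B.carrier) ≫ A.op σ)
    (Pi.lift (fun i => Pi.π _ i ≫ snd A.carrier B.carrier) ≫ B.op σ)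
  sat e he X ρ := by
    apply CartesianMonoidalCategory.hom_ext
    · rw [eval_comp _ A.op, eval_comp _ A.op, A.sat e he]
      all_goals
        intro σ X a
        rw [Category.assoc, lift_fst, ← Category.assoc]
        congr 1
        apply Pi.hom_ext
        intro i
        simp
    · rw [eval_comp _ B.op, eval_comp _ B.op, B.sat e he]
      all_goals
        intro σ X a
        rw [Category.assoc, lift_snd, ← Category.assoc]
        congr 1
        apply Pi.hom_ext
        intro i
        simp

/-- The terminal algebra. -/
abbrev unit (V : Variety.{w}) (E : Type u) [Category.{v} E] [CartesianMonoidalCategory E]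
    [HasFiniteProducts E] : Algebra V E where
  carrier := 𝟙_ E
  op _ := toUnit _
  sat _ _ _ _ := toUnit_unique _ _

lemma isHom_id (A : Algebra V E) : IsHom A A (𝟙 A.carrier) := by
  intro σ X a
  simp only [Category.comp_id]

lemma isHom_comp {A B C : Algebra V E} {f : A.carrier ⟶ B.carrier} {g : B.carrier ⟶ C.carrier}
    (hf : IsHom A B f) (hg : IsHom B C g) : IsHom A C (f ≫ g) := by
  intro σ X a
  rw [← Category.assoc, hf, hg]
  simp only [Category.assoc]

lemma isHom_fst (A B : Algebra V E) : IsHom (A.prod B) A (fst A.carrier B.carrier) := by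
  intro σ X a
  change (Pi.lift a ≫ lift _ _) ≫ fst _ _ = _
  rw [Category.assoc, lift_fst, ← Category.assoc]
  unfold ap
  congr 1
  apply Pi.hom_ext
  intro i
  simp

lemma isHom_snd (A B : Algebra V E) : IsHom (A.prod B) B (snd A.carrier B.carrier) := by
  intro σ X a
  change (Pi.lift a ≫ lift _ _) ≫ snd _ _ = _
  rw [Category.assoc, lift_snd, ← Category.assoc]
  unfold ap
  congr 1
  apply Pi.hom_ext
  intro i
  simp

lemma isHom_lift {A B C : Algebra V E} {f : A.carrier ⟶ B.carrier} {g : A.carrier ⟶ C.carrier}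
    (hf : IsHom A B f) (hg : IsHom A C g) : IsHom A (B.prod C) (lift f g) := by
  intro σ X a
  apply CartesianMonoidalCategory.hom_ext
  · rw [Category.assoc, lift_fst, hf, isHom_fst]
    simp
  · rw [Category.assoc, lift_snd, hg, isHom_snd]
    simp

lemma isHom_toUnit (A : Algebra V E) : IsHom A (unit V E) (toUnit A.carrier) :=
  fun _ _ _ => toUnit_unique _ _

lemma isHom_associator_hom (A B C : Algebra V E) :
    IsHom ((A.prod B).prod C) (A.prod (B.prod C)) (α_ A.carrier B.carrier C.carrier).hom := by
  have h := isHom_lift (isHom_comp (isHom_fst (A.prod B) C) (isHom_fst A B))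
    (isHom_lift (isHom_comp (isHom_fst (A.prod B) C) (isHom_snd A B)) (isHom_snd (A.prod B) C))
  suffices e : (α_ A.carrier B.carrier C.carrier).hom =
      lift (fst _ _ ≫ fst _ _) (lift (fst _ _ ≫ snd _ _) (snd _ _)) by
    rw [e]
    exact h
  apply CartesianMonoidalCategory.hom_ext
  · exact (associator_hom_fst _ _ _).trans (lift_fst _ _).symm
  · refine Eq.trans ?_ (lift_snd _ _).symm
    apply CartesianMonoidalCategory.hom_ext
    · exact (Category.assoc _ _ _).trans
        ((associator_hom_snd_fst _ _ _).trans (lift_fst _ _).symm)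
    · exact (Category.assoc _ _ _).trans
        ((associator_hom_snd_snd _ _ _).trans (lift_snd _ _).symm)

lemma isHom_inv {A B : Algebra V E} (e : A.carrier ≅ B.carrier) (h : IsHom A B e.hom) :
    IsHom B A e.inv := by
  intro σ X b
  rw [← cancel_mono e.hom, Category.assoc, e.inv_hom_id, Category.comp_id, h]
  simp

lemma isHom_leftUnitor_hom (A : Algebra V E) :
    IsHom ((unit V E).prod A) A (λ_ A.carrier).hom := by
  have h := isHom_snd (unit V E) A
  rwa [show snd (unit V E).carrier A.carrier = (λ_ A.carrier).hom from
    (leftUnitor_hom _).symm] at h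

lemma isHom_rightUnitor_hom (A : Algebra V E) :
    IsHom (A.prod (unit V E)) A (ρ_ A.carrier).hom := by
  have h := isHom_fst A (unit V E)
  rwa [show fst A.carrier (unit V E).carrier = (ρ_ A.carrier).hom from
    (rightUnitor_hom _).symm] at h

lemma isHom_braiding_hom [BraidedCategory E] (A B : Algebra V E) :
    IsHom (A.prod B) (B.prod A) (β_ A.carrier B.carrier).hom := by
  have h := isHom_lift (isHom_snd A B) (isHom_fst A B)
  rwa [lift_snd_fst] at h

end Algebra

end Algebras

section AlgebraicRelations

variable {E : Type u} [Category.{v} E] [CartesianMonoidalCategory E] [BraidedCategory E]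
  [HasFiniteLimits E] [MonoidalClosed E] [HasSubobjectClassifier E] {V : Variety.{w}}

open CommQuantale

/-- An algebraic `Q`-relation between `(Σ, E)`-algebras: a morphism `R : A × B ⟶ Q` such that
`R(a₁, b₁) ⊗ ⋯ ⊗ R(aₙ, bₙ) ≤ R(σ(a₁, …, aₙ), σ(b₁, …, bₙ))` for every operation `σ`. -/
@[ext]
structure AlgRel (Q : CommQuantale E) (A B : Algebra V E) where
  /-- The underlying relation. -/
  rel : A.carrier ⊗ B.carrier ⟶ Q.carrier
  algebraic : ∀ (σ : V.Op) {X : E} (a : Fin (V.arity σ) → (X ⟶ A.carrier))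
    (b : Fin (V.arity σ) → (X ⟶ B.carrier)),
    Q.Le (∏ i, (lift (a i) (b i) ≫ rel)) (lift (A.ap σ a) (B.ap σ b) ≫ rel)

namespace AlgRel

variable {Q : CommQuantale E}

/-- The graph of a homomorphism of algebras is an algebraic relation. -/
def graph (Q : CommQuantale E) {A B : Algebra V E} (f : A.carrier ⟶ B.carrier)
    (hf : Algebra.IsHom A B f) : AlgRel Q A B where
  rel := Q.graph f
  algebraic σ X a b := by
    have := prod_graph_le (Q := Q) f a b 1 (lift (A.ap σ a) (B.ap σ b) ≫ Q.graph f) ?_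
    · simpa only [one_mul] using this
    · intro Z h e
      rw [MonObj.comp_one, ← Category.assoc, comp_lift, Algebra.comp_ap, Algebra.comp_ap]
      apply one_le_graph
      rw [hf]
      simp only [Category.assoc, e]

/-- The identity relation of an algebra. -/
protected def id (Q : CommQuantale E) (A : Algebra V E) : AlgRel Q A A where
  rel := Q.relId A.carrier
  algebraic := by
    rw [relId_eq_graph]
    exact (graph Q _ A.isHom_id).algebraic

/-- The composite of algebraic relations. -/
protected def comp {A B C : Algebra V E} (R : AlgRel Q A B) (S : AlgRel Q B C) :
    AlgRel Q A C where
  rel := relComp R.rel S.rel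
  algebraic σ X a c := by
    have := prod_relComp_le R.rel S.rel a c 1
      (lift (A.ap σ a) (C.ap σ c) ≫ relComp R.rel S.rel) ?_
    · simpa only [one_mul] using this
    · intro Z h b
      rw [MonObj.comp_one, one_mul, Finset.prod_mul_distrib, ← Category.assoc, comp_lift,
        Algebra.comp_ap, Algebra.comp_ap]
      exact Le.trans (Le.mul (R.algebraic σ _ b) (S.algebraic σ b _)) (le_relComp _ _ _ _ _)

/-- The tensor product of algebraic relations. -/
protected def tensor {A A' B B' : Algebra V E} (R : AlgRel Q A B) (R' : AlgRel Q A' B') :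
    AlgRel Q (A.prod A') (B.prod B') where
  rel := relTensor R.rel R'.rel
  algebraic σ X a b := by
    have e : ∀ i, lift (a i) (b i) ≫ relTensor R.rel R'.rel = _ :=
      fun i => lift_relTensor R.rel R'.rel (a i) (b i)
    simp only [e]
    rw [Finset.prod_mul_distrib]
    refine Le.trans (Le.mul (R.algebraic σ _ _) (R'.algebraic σ _ _)) ?_
    have := lift_relTensor R.rel R'.rel ((A.prod A').ap σ a) ((B.prod B').ap σ b)
    rw [Algebra.isHom_fst A A' σ a, Algebra.isHom_fst B B' σ b,
      Algebra.isHom_snd A A' σ a, Algebra.isHom_snd B B' σ b] at this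
    rw [this]
    exact Le.refl _

end AlgRel

/-- The category `Rel_{(Σ, E)}(Q)`: its objects are the `(Σ, E)`-algebras and its morphisms the
algebraic `Q`-relations. -/
@[ext]
structure RelCat (V : Variety.{w}) (Q : CommQuantale E) where
  /-- The underlying algebra. -/
  alg : Algebra V E

namespace RelCat

variable {Q : CommQuantale E}

instance : Category (RelCat V Q) where
  Hom A B := AlgRel Q A.alg B.alg
  id A := AlgRel.id Q A.alg
  comp R S := AlgRel.comp R S
  id_comp R := AlgRel.ext (id_relComp R.rel)
  comp_id R := AlgRel.ext (relComp_id R.rel)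
  assoc R S T := AlgRel.ext (relComp_assoc R.rel S.rel T.rel)

/-- The isomorphism given by the graph of an isomorphism of algebras. -/
def isoGraph {A B : RelCat V Q} (e : A.alg.carrier ≅ B.alg.carrier)
    (h : Algebra.IsHom A.alg B.alg e.hom) : A ≅ B where
  hom := AlgRel.graph Q e.hom h
  inv := AlgRel.graph Q e.inv (Algebra.isHom_inv e h)
  hom_inv_id := AlgRel.ext <| by
    refine (graph_comp_graph e.hom e.inv).trans ?_
    rw [e.hom_inv_id]
    exact (relId_eq_graph _).symm
  inv_hom_id := AlgRel.ext <| by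
    refine (graph_comp_graph e.inv e.hom).trans ?_
    rw [e.inv_hom_id]
    exact (relId_eq_graph _).symm

/-- The tensor product is the product of algebras on objects; the unit is the terminal algebra and
the structure isomorphisms are the graphs of the structure isomorphisms of the finite products. -/
instance : MonoidalCategoryStruct (RelCat V Q) where
  tensorObj A B := ⟨A.alg.prod B.alg⟩
  whiskerLeft A {_ _} R := AlgRel.tensor (AlgRel.id Q A.alg) R
  whiskerRight {_ _} R B := AlgRel.tensor R (AlgRel.id Q B.alg)
  tensorHom R S := AlgRel.tensor R S
  tensorUnit := ⟨Algebra.unit V E⟩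
  associator A B C := isoGraph (α_ A.alg.carrier B.alg.carrier C.alg.carrier)
    (Algebra.isHom_associator_hom A.alg B.alg C.alg)
  leftUnitor A := isoGraph (λ_ A.alg.carrier) (Algebra.isHom_leftUnitor_hom A.alg)
  rightUnitor A := isoGraph (ρ_ A.alg.carrier) (Algebra.isHom_rightUnitor_hom A.alg)

lemma relTensor_id (A B : E) :
    relTensor (Q.relId A) (Q.relId B) = Q.relId (A ⊗ B) := by
  rw [relId_eq_graph, relId_eq_graph, relId_eq_graph, graph_tensor_graph, id_tensorHom_id]

/-- A commuting square of relations along graphs of isomorphisms. -/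
lemma graph_square {A A' B B' : E} (R : A ⊗ B ⟶ Q.carrier) (R' : A' ⊗ B' ⟶ Q.carrier)
    (e : A ≅ A') (e' : B ≅ B')
    (h : ∀ {X : E} (a : X ⟶ A) (b : X ⟶ B), lift a b ≫ R = lift (a ≫ e.hom) (b ≫ e'.hom) ≫ R') :
    relComp R (Q.graph e'.hom) = relComp (Q.graph e.hom) R' := by
  apply rel_ext
  intro X a b
  rw [relComp_graph, graph_relComp, h]
  simp

lemma graph_pentagon (A B C D : E) :
    relComp (relTensor (Q.graph (α_ A B C).hom) (Q.relId D))
      (relComp (Q.graph (α_ A (B ⊗ C) D).hom) (relTensor (Q.relId A) (Q.graph (α_ B C D).hom))) =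
        relComp (Q.graph (α_ (A ⊗ B) C D).hom) (Q.graph (α_ A B (C ⊗ D)).hom) := by
  rw [relId_eq_graph, relId_eq_graph, graph_tensor_graph, graph_tensor_graph, graph_comp_graph,
    graph_comp_graph, graph_comp_graph, tensorHom_id, id_tensorHom, MonoidalCategory.pentagon]

lemma graph_triangle (A B : E) :
    relComp (Q.graph (α_ A (𝟙_ E) B).hom) (relTensor (Q.relId A) (Q.graph (λ_ B).hom)) =
      relTensor (Q.graph (ρ_ A).hom) (Q.relId B) := by
  rw [relId_eq_graph, relId_eq_graph, graph_tensor_graph, graph_tensor_graph, graph_comp_graph,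
    tensorHom_id, id_tensorHom, MonoidalCategory.triangle]

lemma graph_hexagon_forward (A B C : E) :
    relComp (Q.graph (α_ A B C).hom)
      (relComp (Q.graph (β_ A (B ⊗ C)).hom) (Q.graph (α_ B C A).hom)) =
    relComp (relTensor (Q.graph (β_ A B).hom) (Q.relId C))
      (relComp (Q.graph (α_ B A C).hom) (relTensor (Q.relId B) (Q.graph (β_ A C).hom))) := by
  rw [relId_eq_graph, relId_eq_graph, graph_tensor_graph, graph_tensor_graph]
  simp only [graph_comp_graph]
  rw [tensorHom_id, id_tensorHom, BraidedCategory.hexagon_forward]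

lemma graph_hexagon_reverse (A B C : E) :
    relComp (Q.graph (α_ A B C).inv)
      (relComp (Q.graph (β_ (A ⊗ B) C).hom) (Q.graph (α_ C A B).inv)) =
    relComp (relTensor (Q.relId A) (Q.graph (β_ B C).hom))
      (relComp (Q.graph (α_ A C B).inv) (relTensor (Q.graph (β_ A C).hom) (Q.relId B))) := by
  rw [relId_eq_graph, relId_eq_graph, graph_tensor_graph, graph_tensor_graph]
  simp only [graph_comp_graph]
  rw [tensorHom_id, id_tensorHom, BraidedCategory.hexagon_reverse]

lemma graph_symmetry (A B : E) :
    relComp (Q.graph (β_ A B).hom) (Q.graph (β_ B A).hom) = Q.relId (A ⊗ B) := by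
  rw [graph_comp_graph, relId_eq_graph, SymmetricCategory.symmetry]

instance : MonoidalCategory (RelCat V Q) := MonoidalCategory.ofTensorHom
  (id_tensorHom_id := fun A B => AlgRel.ext (relTensor_id A.alg.carrier B.alg.carrier))
  (id_tensorHom := fun _ _ _ _ => rfl)
  (tensorHom_id := fun _ _ => rfl)
  (tensorHom_comp_tensorHom := fun R₁ R₂ S₁ S₂ =>
    AlgRel.ext (relTensor_comp R₁.rel R₂.rel S₁.rel S₂.rel))
  (associator_naturality := fun {A₁ A₂ A₃ B₁ B₂ B₃} R₁ R₂ R₃ => AlgRel.ext <| by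
    refine graph_square (Q := Q) (relTensor (relTensor R₁.rel R₂.rel) R₃.rel)
      (relTensor R₁.rel (relTensor R₂.rel R₃.rel)) (α_ _ _ _) (α_ _ _ _) ?_
    intro X a b
    simp only [lift_relTensor, Category.assoc, associator_hom_fst, associator_hom_snd_fst,
      associator_hom_snd_snd, mul_assoc])
  (leftUnitor_naturality := fun {A B} R => AlgRel.ext <| by
    refine graph_square (Q := Q) (relTensor (Q.relId (𝟙_ E)) R.rel) R.rel (λ_ _) (λ_ _) ?_
    intro X a b
    rw [lift_relTensor, relId_eq_graph, leftUnitor_hom, leftUnitor_hom]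
    refine Eq.trans ?_ (one_mul _)
    congr 1
    apply Le.antisymm
    · rw [graph_le_iff]
      intro Z h _
      rw [MonObj.comp_one]
      exact Le.refl _
    · exact one_le_graph _ _ _ (toUnit_unique _ _))
  (rightUnitor_naturality := fun {A B} R => AlgRel.ext <| by
    refine graph_square (Q := Q) (relTensor R.rel (Q.relId (𝟙_ E))) R.rel (ρ_ _) (ρ_ _) ?_
    intro X a b
    rw [lift_relTensor, relId_eq_graph, rightUnitor_hom, rightUnitor_hom]
    refine Eq.trans ?_ (mul_one _)
    congr 1
    apply Le.antisymm
    · rw [graph_le_iff]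
      intro Z h _
      rw [MonObj.comp_one]
      exact Le.refl _
    · exact one_le_graph _ _ _ (toUnit_unique _ _))
  (pentagon := fun A B C D => AlgRel.ext <|
    graph_pentagon A.alg.carrier B.alg.carrier C.alg.carrier D.alg.carrier)
  (triangle := fun A B => AlgRel.ext <| graph_triangle A.alg.carrier B.alg.carrier)

/-- The symmetry is the graph of the symmetry of the finite products. -/
instance : SymmetricCategory (RelCat V Q) where
  braiding A B := isoGraph (A := A ⊗ B) (B := B ⊗ A) (β_ A.alg.carrier B.alg.carrier)
    (Algebra.isHom_braiding_hom A.alg B.alg)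
  braiding_naturality_right A {B C} R := AlgRel.ext <| by
    refine graph_square (Q := Q) (relTensor (Q.relId A.alg.carrier) R.rel)
      (relTensor R.rel (Q.relId A.alg.carrier)) (β_ _ _) (β_ _ _) ?_
    intro X a b
    simp only [lift_relTensor, Category.assoc, braiding_hom_fst, braiding_hom_snd]
    exact mul_comm _ _
  braiding_naturality_left {A B} R C := AlgRel.ext <| by
    refine graph_square (Q := Q) (relTensor R.rel (Q.relId C.alg.carrier))
      (relTensor (Q.relId C.alg.carrier) R.rel) (β_ _ _) (β_ _ _) ?_
    intro X a b
    simp only [lift_relTensor, Category.assoc, braiding_hom_fst, braiding_hom_snd]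
    exact mul_comm _ _
  hexagon_forward A B C := AlgRel.ext <|
    graph_hexagon_forward A.alg.carrier B.alg.carrier C.alg.carrier
  hexagon_reverse A B C := AlgRel.ext <|
    graph_hexagon_reverse A.alg.carrier B.alg.carrier C.alg.carrier
  symmetry A B := AlgRel.ext <| graph_symmetry A.alg.carrier B.alg.carrier

end RelCat

end AlgebraicRelations

section Enrichment

/-- A `Pos`-enriched (partially ordered) symmetric monoidal category: the hom-sets are partially
ordered, and composition and tensor product are monotone in both arguments. -/
class PosMonoidal (C : Type u) [Category.{v} C] [MonoidalCategory C] where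
  /-- The order on the hom-sets. -/
  homOrder (X Y : C) : PartialOrder (X ⟶ Y)
  comp_le_comp {X Y Z : C} {f f' : X ⟶ Y} {g g' : Y ⟶ Z} :
    f ≤ f' → g ≤ g' → f ≫ g ≤ f' ≫ g'
  tensor_le_tensor {X Y X' Y' : C} {f f' : X ⟶ Y} {g g' : X' ⟶ Y'} :
    f ≤ f' → g ≤ g' → f ⊗ₘ g ≤ f' ⊗ₘ g'

attribute [reducible, instance] PosMonoidal.homOrder

/-- A `Pos`-functor: a functor that is monotone on hom-sets. -/
def IsPosFunctor {C D : Type*} [Category* C] [MonoidalCategory C] [PosMonoidal C]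
    [Category* D] [MonoidalCategory D] [PosMonoidal D] (F : C ⥤ D) : Prop :=
  ∀ {X Y : C} (f g : X ⟶ Y), f ≤ g → F.map f ≤ F.map g

/-- A strict symmetric monoidal functor: a symmetric monoidal functor whose structure morphisms
`𝟙 ⟶ F 𝟙` and `F X ⊗ F Y ⟶ F (X ⊗ Y)` are identities. -/
def IsStrictSymmetricMonoidal {C D : Type*} [Category* C] [MonoidalCategory C]
    [SymmetricCategory C] [Category* D] [MonoidalCategory D] [SymmetricCategory D]
    (F : C ⥤ D) : Prop :=
  ∃ _ : F.Braided, (∃ e, Functor.LaxMonoidal.ε F = eqToHom e) ∧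
    ∀ X Y : C, ∃ e, Functor.LaxMonoidal.μ F X Y = eqToHom e

variable {E : Type u} [Category.{v} E] [CartesianMonoidalCategory E] [BraidedCategory E]
  [HasFiniteLimits E] [MonoidalClosed E] [HasSubobjectClassifier E] {V : Variety.{w}}
  {Q : CommQuantale E}

/-- Algebraic relations are ordered by `R ⊆ R'` iff `R(a, b) ≤ R'(a, b)` for all `a`, `b`. -/
instance (A B : Algebra V E) : PartialOrder (AlgRel Q A B) where
  le R R' := ∀ {X : E} (a : X ⟶ A.carrier) (b : X ⟶ B.carrier),
    Q.Le (lift a b ≫ R.rel) (lift a b ≫ R'.rel)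
  le_refl R X a b := CommQuantale.Le.refl _
  le_trans R S T h h' X a b := CommQuantale.Le.trans (h a b) (h' a b)
  le_antisymm R S h h' := AlgRel.ext <| CommQuantale.rel_ext fun a b =>
    CommQuantale.Le.antisymm (h a b) (h' a b)

lemma AlgRel.le_iff {A B : Algebra V E} {R R' : AlgRel Q A B} :
    R ≤ R' ↔ Q.Le R.rel R'.rel := by
  constructor
  · intro h
    have := h (fst _ _) (snd _ _)
    simpa using this
  · intro h X a b
    exact h.comp _

instance : PosMonoidal (RelCat V Q) where
  homOrder A B := inferInstanceAs (PartialOrder (AlgRel Q A.alg B.alg))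
  comp_le_comp h h' := AlgRel.le_iff.2
    (CommQuantale.relComp_mono (AlgRel.le_iff.1 h) (AlgRel.le_iff.1 h'))
  tensor_le_tensor h h' := AlgRel.le_iff.2
    (CommQuantale.relTensor_mono (AlgRel.le_iff.1 h) (AlgRel.le_iff.1 h'))

end Enrichment

end QRel

end

namespace QRel

namespace CommQuantale

variable {E : Type u} [Category.{v} E] [CartesianMonoidalCategory E] [BraidedCategory E]
  [HasFiniteLimits E] [MonoidalClosed E] [HasSubobjectClassifier E]

/-! ### Morphisms of quantales commute with the operations on relations. -/

namespace Hom

variable {Q₁ Q₂ : CommQuantale E} (h : Hom Q₁ Q₂)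

/-! All the structure of `RelCat V Q` is built from three ingredients: the unit `k`, the
multiplication of `Q`, and joins of internally defined subsets. Identities and graphs are joins `⋁
{k | φ}`, composition is `⋁_b R(a, b) ⊗ S(b, c)`, and the tensor is a pointwise product. A morphism
`h` preserves all three ingredients, so postcomposition with `h` commutes on the nose with each of
these constructions.

The only real work concerns joins. Preservation of joins says that `h(⋁ S)` is the least upper bound
of the elements `h(s)` with `s ∈ S`, at all stages, whereas the relations are defined through the
indexed join `iSup` and the truth-conditioned join `guard`. `iSup_comp` and `guard_comp` carry
preservation over to these two forms; in both, the two sides are shown to have the same upper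
bounds.

Order is no extra assumption on `h`: since `y` is the join of its down-set, preservation of joins
forces monotonicity (`Hom.mono`). Monotonicity gives the `Pos`-functor property. Together with
preservation of finite products it shows that `h ∘ R` is again algebraic.

Neither the algebras nor their products depend on the quantale, so the functor is the identity on
objects and the comparison maps can be taken to be identities. The coherence axioms then say only
that associator, unitors and symmetry are sent to their counterparts. These are graphs of maps of
`E`, hence preserved by `graph_comp`. Functoriality in `h` is unitality and associativity of
composition in `E`. -/

lemma one_comp (X : E) : (1 : X ⟶ Q₁.carrier) ≫ h.hom = 1 := by
  rw [Hom.one_def, Hom.one_def, Category.assoc, h.one_hom]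

lemma mul_comp {X : E} (x y : X ⟶ Q₁.carrier) :
    (x * y) ≫ h.hom = (x ≫ h.hom) * (y ≫ h.hom) := by
  rw [Hom.mul_def, Hom.mul_def, Category.assoc, h.mul_hom, lift_map_assoc]

/-- Needed for the left-hand side of the algebraicity inequality. The empty product is the case of a
constant symbol, and there preservation of the unit is used. -/
lemma prod_comp {X : E} {n : ℕ} (x : Fin n → (X ⟶ Q₁.carrier)) :
    (∏ i, x i) ≫ h.hom = ∏ i, x i ≫ h.hom := by
  induction n with
  | zero => simpa using h.one_comp X
  | succ n ih => rw [Fin.prod_univ_succ, Fin.prod_univ_succ, h.mul_comp, ih]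

/-- An adjoint-functor argument: a join-preserving map has a right adjoint, and a map with a right
adjoint preserves every join, in particular an indexed one. Only the universal property of `iSup` is
used, so the existential in its definition need not be unfolded. -/
lemma iSup_comp_le_iff {B X Y : E} (f : B ⊗ X ⟶ Q₁.carrier) (g : Y ⟶ X) (t : Y ⟶ Q₂.carrier) :
    Q₂.Le ((g ≫ Q₁.iSup f) ≫ h.hom) t ↔ ∀ {Z : E} (k : Z ⟶ Y) (b : Z ⟶ B),
      Q₂.Le (lift b (k ≫ g) ≫ f ≫ h.hom) (k ≫ t) := by
  -- `T = {z | h(z) ≤ t}`; its join is the value at `t` of the right adjoint of `h`.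
  let T : Y ⟶ PowObj Q₁.carrier := setOfF (lift (fst _ Y ≫ h.hom) (snd _ Y ≫ t) ≫ Q₂.le)
  have hT : ∀ {Z : E} (k : Z ⟶ Y) (z : Z ⟶ Q₁.carrier),
      Mem z (k ≫ T) ↔ Q₂.Le (z ≫ h.hom) (k ≫ t) := by
    intro Z k z
    rw [mem_setOfF, ← Category.assoc, comp_lift, lift_fst_assoc, lift_snd_assoc]
    rfl
  constructor
  · intro H Z k b
    -- Each `f(b, x)` lies below the join; apply the monotone `h`.
    have h1 := h.mono ((iSup_le_iff f g _).1 (Le.refl (Q := Q₁) _) k b)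
    rw [Category.assoc] at h1
    refine h1.trans ?_
    simpa only [Category.assoc] using H.comp k
  · intro H
    -- By hypothesis every `f(b, x)` belongs to `T`, so the indexed join is at most `⋁ T`. It then
    -- remains to see `h(⋁ T) ≤ t`, which is preservation of joins applied to `T`.
    have h1 : Q₁.Le (g ≫ Q₁.iSup f) (T ≫ Q₁.sup) := by
      rw [iSup_le_iff]
      intro Z k b
      refine (Q₁.sup_le_iff T _).1 (Le.refl _) k _ ((hT _ _).2 ?_)
      rw [Category.assoc]
      exact H k b
    refine (h.mono h1).trans ?_
    rw [h.sup_hom_le_iff]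
    intro Z k s hs
    exact (hT _ _).1 hs

lemma iSup_comp {B X : E} (f : B ⊗ X ⟶ Q₁.carrier) :
    Q₁.iSup f ≫ h.hom = Q₂.iSup (f ≫ h.hom) := by
  apply eq_of_le_iff
  intro t
  have h1 := h.iSup_comp_le_iff f (𝟙 X) t
  have h2 := iSup_le_iff (Q := Q₂) (f ≫ h.hom) (𝟙 X) t
  rw [Category.id_comp] at h1 h2
  exact h1.trans h2.symm

/-- The set `{q | q = k ∧ φ}` has at most the element `k`, which `h` sends to the unit of `Q₂`.
Hence on both sides `t` is an upper bound exactly when `k ≤ t` at every stage where `φ` holds. -/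
lemma guard_comp {X : E} (φ : X ⟶ Om E) : Q₁.guard φ ≫ h.hom = Q₂.guard φ := by
  apply eq_of_le_iff
  intro t
  have h2 := guard_le_iff (Q := Q₂) φ (𝟙 X) t
  simp only [Category.id_comp] at h2
  rw [h2]
  refine (h.sup_hom_le_iff _ t).trans ⟨fun H Z k hk => ?_, fun H Z k s hs => ?_⟩
  · rw [← h.one_comp]
    -- Where `φ` holds, the unit itself is a member of the set, so it serves as the witness.
    apply H k 1
    rw [mem_setOfF, holds_andF, holds_eqF]
    simpa only [lift_fst, MonObj.comp_one, true_and, lift_snd_assoc] using hk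
  · rw [mem_setOfF, holds_andF, holds_eqF] at hs
    simp only [lift_fst, MonObj.comp_one, lift_snd_assoc] at hs
    rw [hs.1, h.one_comp]
    exact H k hs.2

/-- The condition `f(a) = b` is a formula of `E` that does not mention the quantale. This is what
makes the associator, unitors and symmetry strictly preserved. -/
lemma graph_comp {A B : E} (f : A ⟶ B) : Q₁.graph f ≫ h.hom = Q₂.graph f :=
  h.guard_comp _

lemma relId_comp (A : E) : Q₁.relId A ≫ h.hom = Q₂.relId A :=
  h.guard_comp _

lemma relComp_comp {A B C : E} (R : A ⊗ B ⟶ Q₁.carrier) (S : B ⊗ C ⟶ Q₁.carrier) :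
    relComp R S ≫ h.hom = relComp (R ≫ h.hom) (S ≫ h.hom) := by
  unfold relComp
  rw [h.iSup_comp, h.mul_comp, Category.assoc, Category.assoc]

lemma relTensor_comp {A A' B B' : E} (R : A ⊗ B ⟶ Q₁.carrier) (R' : A' ⊗ B' ⟶ Q₁.carrier) :
    relTensor R R' ≫ h.hom = relTensor (R ≫ h.hom) (R' ≫ h.hom) := by
  unfold relTensor
  rw [h.mul_comp, Category.assoc, Category.assoc]

end Hom

end CommQuantale

/-! ### Change of base on algebraic relations. -/

variable {E : Type u} [Category.{v} E] [CartesianMonoidalCategory E] [BraidedCategory E]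
  [HasFiniteLimits E] [MonoidalClosed E] [HasSubobjectClassifier E] {V : Variety.{w}}
  {Q₁ Q₂ : CommQuantale E}

open CommQuantale

/-- Postcomposition of an algebraic relation with a morphism of quantales. -/
def AlgRel.map {A B : Algebra V E} (h : Hom Q₁ Q₂) (R : AlgRel Q₁ A B) : AlgRel Q₂ A B where
  rel := R.rel ≫ h.hom
  algebraic σ X a b := by
    -- Apply `h` to the algebraicity inequality of `R`, then move it inside the finite product.
    have := h.mono (R.algebraic σ a b)
    rw [h.prod_comp] at this
    simpa only [Category.assoc] using this

/-! ### The change-of-base functor, its strict monoidal structure and its functoriality. -/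

namespace RelCat

/-- The change of base `h^* : Rel(Q₁) ⥤ Rel(Q₂)` along a morphism of quantales. -/
noncomputable def changeBase (V : Variety.{w}) (h : Hom Q₁ Q₂) : RelCat V Q₁ ⥤ RelCat V Q₂ where
  obj A := ⟨A.alg⟩
  map R := AlgRel.map h R
  map_id A := AlgRel.ext (h.relId_comp A.alg.carrier)
  map_comp R S := AlgRel.ext (h.relComp_comp R.rel S.rel)

variable (V) (h : Hom Q₁ Q₂)

lemma changeBase_map_tensorHom {A A' B B' : RelCat V Q₁} (R : A ⟶ B) (R' : A' ⟶ B') :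
    (changeBase V h).map (R ⊗ₘ R') = (changeBase V h).map R ⊗ₘ (changeBase V h).map R' :=
  AlgRel.ext (h.relTensor_comp R.rel R'.rel)

/-- The common source of all coherence conditions below: associator, unitors and braiding are each
an `isoGraph`. -/
lemma changeBase_map_isoGraph_hom {A B : RelCat V Q₁} (e : A.alg.carrier ≅ B.alg.carrier)
    (he : Algebra.IsHom A.alg B.alg e.hom) :
    (changeBase V h).map (isoGraph e he).hom =
      (isoGraph (A := (changeBase V h).obj A) (B := (changeBase V h).obj B) e he).hom :=
  AlgRel.ext (h.graph_comp e.hom)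

/-- Change of base is strict monoidal. -/
noncomputable def changeBaseCore : (changeBase V h).CoreMonoidal where
  -- The unit and product algebras are the same over `Q₁` and `Q₂`, so source and target of the
  -- comparison maps agree definitionally and identities typecheck.
  εIso := Iso.refl _
  μIso _ _ := Iso.refl _
  μIso_hom_natural_left {A B} R C := by
    refine (Category.comp_id _).trans (Eq.trans ?_ (Category.id_comp _).symm)
    -- Whiskering is tensoring with an identity, so naturality reduces to preservation of tensors
    -- and of identities.
    rw [← tensorHom_id, ← tensorHom_id, changeBase_map_tensorHom, CategoryTheory.Functor.map_id]
  μIso_hom_natural_right {A B} C R := by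
    refine (Category.comp_id _).trans (Eq.trans ?_ (Category.id_comp _).symm)
    rw [← id_tensorHom, ← id_tensorHom, changeBase_map_tensorHom, CategoryTheory.Functor.map_id]
  associativity A B C := by
    have e := changeBase_map_isoGraph_hom V h (A := (A ⊗ B) ⊗ C) (B := A ⊗ (B ⊗ C)) _
      (Algebra.isHom_associator_hom A.alg B.alg C.alg)
    have e1 := id_whiskerRight ((changeBase V h).obj A ⊗ (changeBase V h).obj B)
      ((changeBase V h).obj C)
    have e2 := whiskerLeft_id ((changeBase V h).obj A)
      ((changeBase V h).obj B ⊗ (changeBase V h).obj C)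
    -- Whiskered identities become identities and the image of the associator becomes the
    -- associator, leaving `𝟙 ≫ 𝟙 ≫ α = α ≫ 𝟙 ≫ 𝟙`. The equations are chained as terms because they
    -- match the goal only up to definitional unfolding.
    refine (congrArg₂ (· ≫ ·) e1 (congrArg₂ (· ≫ ·) rfl e)).trans ?_
    refine Eq.trans ?_ (congrArg₂ (· ≫ ·) rfl (congrArg₂ (· ≫ ·) e2 rfl)).symm
    refine (Category.id_comp _).trans ((Category.id_comp _).trans ?_)
    exact ((congrArg₂ (· ≫ ·) rfl (Category.id_comp _)).trans (Category.comp_id _)).symm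
  left_unitality A := by
    have e := changeBase_map_isoGraph_hom V h (A := 𝟙_ (RelCat V Q₁) ⊗ A) (B := A) _
      (Algebra.isHom_leftUnitor_hom A.alg)
    have e1 := id_whiskerRight (𝟙_ (RelCat V Q₂)) ((changeBase V h).obj A)
    refine Eq.symm ((congrArg₂ (· ≫ ·) e1 (congrArg₂ (· ≫ ·) rfl e)).trans ?_)
    exact (Category.id_comp _).trans (Category.id_comp _)
  right_unitality A := by
    have e := changeBase_map_isoGraph_hom V h (A := A ⊗ 𝟙_ (RelCat V Q₁)) (B := A) _
      (Algebra.isHom_rightUnitor_hom A.alg)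
    have e1 := whiskerLeft_id ((changeBase V h).obj A) (𝟙_ (RelCat V Q₂))
    refine Eq.symm ((congrArg₂ (· ≫ ·) e1 (congrArg₂ (· ≫ ·) rfl e)).trans ?_)
    exact (Category.id_comp _).trans (Category.id_comp _)

/-- Change of base is a braided functor. -/
@[reducible] noncomputable def changeBaseBraided : (changeBase V h).Braided where
  toMonoidal := (changeBaseCore V h).toMonoidal
  braided A B := by
    have e := changeBase_map_isoGraph_hom V h (A := A ⊗ B) (B := B ⊗ A) _
      (Algebra.isHom_braiding_hom A.alg B.alg)
    exact (Category.id_comp _).trans (e.trans (Category.comp_id _).symm)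

lemma isStrictSymmetricMonoidal_changeBase : IsStrictSymmetricMonoidal (changeBase V h) :=
  -- In each pair the first `rfl` is the equality of objects; `eqToHom` of it unfolds to the
  -- identity, which is the chosen comparison map.
  ⟨changeBaseBraided V h, ⟨rfl, rfl⟩, fun _ _ => ⟨rfl, rfl⟩⟩

lemma isPosFunctor_changeBase : IsPosFunctor (changeBase V h) := fun _ _ H =>
  AlgRel.le_iff.2 (h.mono (AlgRel.le_iff.1 H))

/-- Objects agree by structure eta, so the heterogeneous equality of morphisms is an ordinary one.
-/
lemma changeBase_id (Q : CommQuantale E) : changeBase V (Hom.id Q) = 𝟭 (RelCat V Q) :=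
  Functor.hext (fun _ => rfl) fun _ _ R => heq_of_eq (AlgRel.ext (Category.comp_id R.rel))

lemma changeBase_comp {Q₃ : CommQuantale E} (k : Hom Q₂ Q₃) :
    changeBase V (h.comp k) = changeBase V h ⋙ changeBase V k :=
  Functor.hext (fun _ => rfl) fun _ _ R =>
    heq_of_eq (AlgRel.ext (Category.assoc R.rel h.hom k.hom).symm)

end RelCat

end QRel

theorem mainTheorem5 {E : Type u} [Category.{v} E] [CartesianMonoidalCategory E]
    [BraidedCategory E] [HasFiniteLimits E] [MonoidalClosed E] [HasSubobjectClassifier E]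
    (V : QRel.Variety.{w}) :
    ∃ star : ∀ {Q₁ Q₂ : QRel.CommQuantale E}, (Q₁ ⟶ Q₂) →
        (QRel.RelCat V Q₁ ⥤ QRel.RelCat V Q₂),
      (∀ {Q₁ Q₂ : QRel.CommQuantale E} (h : Q₁ ⟶ Q₂),
        (∀ A : QRel.RelCat V Q₁, ((star h).obj A).alg = A.alg) ∧
        (∀ {A B : QRel.RelCat V Q₁} (R : A ⟶ B), HEq ((star h).map R).rel (R.rel ≫ h.hom)) ∧
        QRel.IsStrictSymmetricMonoidal (star h) ∧
        QRel.IsPosFunctor (star h)) ∧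
      (∀ Q : QRel.CommQuantale E, star (𝟙 Q) = 𝟭 (QRel.RelCat V Q)) ∧
      (∀ {Q₁ Q₂ Q₃ : QRel.CommQuantale E} (h : Q₁ ⟶ Q₂) (k : Q₂ ⟶ Q₃),
        star (h ≫ k) = star h ⋙ star k) :=
  ⟨fun h => QRel.RelCat.changeBase V h,
    -- With `star` existentially bound, the two relations have types that are not syntactically
    -- equal, hence the `HEq`; for `changeBase` they coincide definitionally.
    fun h => ⟨fun _ => rfl, fun _ => HEq.rfl,
      QRel.RelCat.isStrictSymmetricMonoidal_changeBase V h,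
      QRel.RelCat.isPosFunctor_changeBase V h⟩,
    QRel.RelCat.changeBase_id V, fun h k => QRel.RelCat.changeBase_comp V h k⟩
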